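/- Let $d\ge 2$ and let $\lambda_1,\dots,\lambda_{d^2-1}\in M_d(\mathbb C)$ be hermitian generators of $\mathfrak{su}(d)$, that is, hermitian traceless matrices with $\operatorname{tr}(\lambda_j\lambda_k)=2\delta_{jk}$. For $U\in SU(d)$ let $R(U)$ be the real matrix $R(U)_{jk}=\frac12\operatorname{tr}(U\lambda_kU^*\lambda_j)$, and put $G(d)=R(SU(d))$. Let $I_0$ be the matrix of the transposition, $(I_0)_{jk}=\frac12\operatorname{tr}(\lambda_j^T\lambda_k)$ (for the generalized Gell-Mann matrices it is diagonal with entries $\pm1$). A state $\rho$ on $\mathbb C^d\otimes\mathbb C^d$ is locally maximally mixed if both of its partial traces equal $\mathbb 1_d/d$; its correlation matrix is $K_{jk}=\frac{d^2}{4}\operatorname{tr}(\rho\,\lambda_j\otimes\lambda_k)$. Local projective measurements on the first qudit are the maps $\mathbb P_A(\rho)=\sum_{k=1}^d(P_k\otimes\mathbb 1)\rho(P_k\otimes\mathbb 1)$ with one-dimensional orthogonal projectors $P_k$, $P_jP_k=\delta_{jk}P_k$, $\sum_kP_k=\mathbb 1$. The trace-norm measurement-induced discord is $$D_1^M(\rho)=\frac{d}{2(d-1)}\min_{\mathbb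 P_A}\|\rho-\mathbb P_A(\rho)\|_1 ,\qquad \|X\|_1=\operatorname{tr}\sqrt{X^*X},$$ and for a measurement let $S=\rho-\mathbb P_A(\rho)$ and $Q=SS^*$. Let $t\in\mathbb R$. 1. Class $\mathfrak E^{a}$. For each $V\in G(d)$ there is a locally maximally mixed state with correlation matrix $K=tV$ if and only if $-\frac{d}{2(d-1)}\le t\le\frac{d}{2(d+1)}$. For every such state $\rho$ the minimum is attained and $D_1^M(\rho)=|t|$; moreover the spectrum of $Q$ is the same for every local measurement: the eigenvalue $4t^2/d^4$ with multiplicity $d(d-1)$ and $0$ with multiplicity $d$. 2. Class $\mathfrak E^{aa}$. For all $V_1,V_2\in G(d)$ there is a locally maximally mixed state with correlation matrix $K=t\,V_1I_0V_2^T$ if and only if $-\frac{d}{2(d^2-1)}\le t\le\frac d2$. For every such state $\rho$ the minimum is attained and $D_1^M(\rho)=\frac2d|t|$; moreover the spectrum of $Q$ is the same for every local measurement: the eigenvalue $4t^2(d-1)^2/d^4$ with multiplicity $1$, $4t^2/d^4$ with multiplicity $d-1$, and $0$ with multiplicity $d(d-1)$. (Multiplicities are added when the listed values coincide.) -/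

import Mathlib

open Matrix
open scoped Kronecker

namespace QuditDiscord

noncomputable section

/-- `d × d` complex matrices: the operators of one qudit. -/
abbrev Op (d : ℕ) : Type := Matrix (Fin d) (Fin d) ℂ

/-- Operators of two qudits `A`, `B`, on `ℂ^d ⊗ ℂ^d`; the first index belongs to `A`. -/
abbrev Op2 (d : ℕ) : Type := Matrix (Fin d × Fin d) (Fin d × Fin d) ℂ

/-- `λ_1, …, λ_{d²-1}` are hermitian generators of `su(d)`: hermitian, traceless, and
normalized by `tr (λ_j λ_k) = 2 δ_{jk}`. -/
structure IsGenerators {d : ℕ} (lam : Fin (d ^ 2 - 1) → Op d) : Prop where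
  hermitian : ∀ j, (lam j).IsHermitian
  traceless : ∀ j, (lam j).trace = 0
  orthonormal : ∀ j k, (lam j * lam k).trace = if j = k then 2 else 0

open scoped ComplexOrder in
/-- A density matrix of two qudits. -/
def IsState {d : ℕ} (ρ : Op2 d) : Prop := ρ.PosSemidef ∧ ρ.trace = 1

/-- The partial trace over the subsystem `A`. -/
def ptraceA {d : ℕ} (ρ : Op2 d) : Op d := Matrix.of fun i j => ∑ k, ρ (k, i) (k, j)

/-- The partial trace over the subsystem `B`. -/
def ptraceB {d : ℕ} (ρ : Op2 d) : Op d := Matrix.of fun i j => ∑ k, ρ (i, k) (j, k)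

/-- Both reductions of `ρ` are maximally mixed, i.e. equal to `𝟙_d / d`. -/
def IsLocallyMaximallyMixed {d : ℕ} (ρ : Op2 d) : Prop :=
  ptraceA ρ = (d : ℂ)⁻¹ • (1 : Op d) ∧ ptraceB ρ = (d : ℂ)⁻¹ • (1 : Op d)

/-- The correlation matrix `K_{jk} = (d²/4) tr (ρ (λ_j ⊗ λ_k))`
(for hermitian `ρ` and hermitian `λ_j` this trace is real). -/
def correlationMatrix {d : ℕ} (lam : Fin (d ^ 2 - 1) → Op d) (ρ : Op2 d) :
    Matrix (Fin (d ^ 2 - 1)) (Fin (d ^ 2 - 1)) ℝ :=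
  Matrix.of fun j k => (d : ℝ) ^ 2 / 4 * (ρ * (lam j ⊗ₖ lam k)).trace.re

/-- The locally maximally mixed states with correlation matrix `K`. -/
def lmmStates {d : ℕ} (lam : Fin (d ^ 2 - 1) → Op d)
    (K : Matrix (Fin (d ^ 2 - 1)) (Fin (d ^ 2 - 1)) ℝ) : Set (Op2 d) :=
  {ρ | IsState ρ ∧ IsLocallyMaximallyMixed ρ ∧ correlationMatrix lam ρ = K}

/-- The adjoint matrix `R(U)_{jk} = ½ tr (U λ_k U* λ_j)` of a matrix `U`, so that
`U λ_k U* = ∑_j R(U)_{jk} λ_j` for unitary `U` (the trace is real). -/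
def adjointMatrix {d : ℕ} (lam : Fin (d ^ 2 - 1) → Op d) (U : Op d) :
    Matrix (Fin (d ^ 2 - 1)) (Fin (d ^ 2 - 1)) ℝ :=
  Matrix.of fun j k => (1 / 2 : ℝ) * (U * lam k * Uᴴ * lam j).trace.re

/-- `G(d)`, the image of `SU(d)` under the adjoint representation `R`. -/
def adjointGroup {d : ℕ} (lam : Fin (d ^ 2 - 1) → Op d) :
    Set (Matrix (Fin (d ^ 2 - 1)) (Fin (d ^ 2 - 1)) ℝ) :=
  {V | ∃ U ∈ Matrix.specialUnitaryGroup (Fin d) ℂ, V = adjointMatrix lam U}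

/-- The matrix `I₀` of the transposition in the basis `λ`: `(I₀)_{jk} = ½ tr (λ_jᵀ λ_k)`, so that
`λ_kᵀ = ∑_j (I₀)_{jk} λ_j`. When every `λ_k` is symmetric or antisymmetric, as for the generalized
Gell-Mann matrices, it is the diagonal matrix with entries `½ tr (λ_kᵀ λ_k) = ±1`. -/
def transpositionMatrix {d : ℕ} (lam : Fin (d ^ 2 - 1) → Op d) :
    Matrix (Fin (d ^ 2 - 1)) (Fin (d ^ 2 - 1)) ℝ :=
  Matrix.of fun j k => (1 / 2 : ℝ) * ((lam j)ᵀ * lam k).trace.re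

/-- The states of the class `𝔈^a` with parameter `t`: correlation matrix `t V`, `V ∈ G(d)`. -/
def classA {d : ℕ} (lam : Fin (d ^ 2 - 1) → Op d) (t : ℝ) : Set (Op2 d) :=
  {ρ | ∃ V ∈ adjointGroup lam, ρ ∈ lmmStates lam (t • V)}

/-- The states of the class `𝔈^aa` with parameter `t`: correlation matrix `t V₁ I₀ V₂ᵀ`,
`V₁, V₂ ∈ G(d)`. -/
def classAA {d : ℕ} (lam : Fin (d ^ 2 - 1) → Op d) (t : ℝ) : Set (Op2 d) :=
  {ρ | ∃ V₁ ∈ adjointGroup lam, ∃ V₂ ∈ adjointGroup lam,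
    ρ ∈ lmmStates lam (t • (V₁ * transpositionMatrix lam * V₂ᵀ))}

/-- A projective measurement on one qudit: one-dimensional orthogonal projectors
`P_1, …, P_d` with `P_j P_k = δ_{jk} P_k` and `∑_k P_k = 𝟙`. -/
structure Measurement (d : ℕ) where
  proj : Fin d → Op d
  hermitian : ∀ k, (proj k).IsHermitian
  mul_proj : ∀ j k, proj j * proj k = if j = k then proj k else 0
  rank_one : ∀ k, (proj k).rank = 1
  sum_proj : ∑ k, proj k = 1

/-- The map `ℙ_A = ℙ ⊗ id` on the operators of two qudits, where `ℙ(X) = ∑_k P_k X P_k`. -/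
def Measurement.onA {d : ℕ} (P : Measurement d) (ρ : Op2 d) : Op2 d :=
  ∑ k, (P.proj k ⊗ₖ (1 : Op d)) * ρ * (P.proj k ⊗ₖ (1 : Op d))

/-- The disturbance `S = ρ - ℙ_A(ρ)`. -/
def disturbance {d : ℕ} (P : Measurement d) (ρ : Op2 d) : Op2 d := ρ - P.onA ρ

/-- The operator `Q = S S*`. -/
def disturbanceSq {d : ℕ} (P : Measurement d) (ρ : Op2 d) : Op2 d :=
  disturbance P ρ * (disturbance P ρ)ᴴ

open scoped MatrixOrder in
/-- The trace norm `‖X‖₁ = tr |X|`, `|X| = √(X* X)`. -/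
def traceNorm {d : ℕ} (X : Op2 d) : ℝ := (CFC.abs X).trace.re

/-- The numbers `d / (2 (d - 1)) ‖ρ - ℙ_A(ρ)‖₁`, over all local measurements on `A`. -/
def discordValues {d : ℕ} (ρ : Op2 d) : Set ℝ :=
  Set.range fun P : Measurement d =>
    (d : ℝ) / (2 * ((d : ℝ) - 1)) * traceNorm (disturbance P ρ)

/-- The trace-norm measurement-induced geometric discord `D₁^M`. -/
def discord {d : ℕ} (ρ : Op2 d) : ℝ := sInf (discordValues ρ)

end

end QuditDiscord

/-!
The hermitian matrices `1, λ_1, …, λ_{d²-1}` form an orthogonal basis of `M_d(ℂ)`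
(`IsGenerators.expansion`), so an operator on `ℂ^d ⊗ ℂ^d` is determined by its partial traces and the
numbers `tr (X (λ_j ⊗ λ_k))`. A locally maximally mixed state with correlation matrix `t K` is therefore
unique, and equal to `mixture t N = d⁻² (1 + 2t (N - 1/d))` for any operator `N` with both partial
traces `1` and `tr (N (λ_j ⊗ λ_k)) = 2 K_{jk}`; it exists iff `mixture t N` is positive semidefinite
(`IsGenerators.mem_lmmStates_iff`).

For `K = R(U)` one can take `N = (U ⊗ 1) F (U ⊗ 1)*` with `F` the swap, and for `K = R(U) I₀ R(W)ᵀ`,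
`N = (U ⊗ W) Ω (U ⊗ W)*` with `Ω = ∑ |i i⟩⟨j j|`, the partial transpose of `F`. Since `(1 + F)/2` and
`Ω/d` are projections, `mixture t N` is a combination of a projection and its complement, and
positivity amounts to two linear inequalities in `t` (`posSemidef_projection_iff`).

A measurement is given by an orthonormal basis, that is, by a unitary `V`. As `F` is invariant under
`Y ⊗ Y` and `Ω` under `Y ⊗ conj Y`, the operator `N` is also `(V ⊗ Y) M (V ⊗ Y)*` with `M = F` or
`M = Ω` (`exists_conj_swap`, `exists_conj_ent`). Hence, up to the unitary `V ⊗ Y`, the disturbance is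
`2t/d²` times the part of `M` that is off-diagonal on the first qudit, whatever the measurement
(`discord_mixture`). The square of this part is the projection onto the `e_i ⊗ e_j` with `i ≠ j` for
`M = F`. For `M = Ω` it lives on the span of the `e_i ⊗ e_i`, where it is `J - 1` with `J` the matrix of
ones. This gives the spectra and, through explicit positive square roots, the trace norms.
-/

namespace QuditDiscord

/-! ### Generators and the expansion of a locally maximally mixed state -/

section Generators

variable {d : ℕ} {lam : Fin (d ^ 2 - 1) → Op d}

/-- Completeness of the generators: together with `1` they form an orthogonal basis of `M_d(ℂ)`. -/
theorem IsGenerators.expansion (hlam : IsGenerators lam) (hd : 0 < d) (Y : Op d) :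
    Y = (Y.trace / d) • (1 : Op d) + ∑ k, ((lam k * Y).trace / 2) • lam k := by
  have hd0 : (d : ℂ) ≠ 0 := by exact_mod_cast hd.ne'
  let e : Option (Fin (d ^ 2 - 1)) → Op d := fun o => o.elim 1 lam
  let w : Option (Fin (d ^ 2 - 1)) → ℂ := fun o => o.elim (d : ℂ)⁻¹ fun _ => 2⁻¹
  -- The orthogonality relations say `A * B = 1`; as both index types have `d²` elements,
  -- also `B * A = 1`, which is the completeness relation.
  let A : Matrix (Option (Fin (d ^ 2 - 1))) (Fin d × Fin d) ℂ := of fun o p => e o p.2 p.1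
  let B : Matrix (Fin d × Fin d) (Option (Fin (d ^ 2 - 1))) ℂ := of fun p o => w o * e o p.1 p.2
  have hAB : A * B = 1 := by
    have h (o o') : (A * B) o o' = w o' * (e o * e o').trace := by
      simp only [A, B, mul_apply, of_apply, trace, diag_apply, Fintype.sum_prod_type,
        Finset.mul_sum]
      rw [Finset.sum_comm]
      refine Finset.sum_congr rfl fun _ _ => Finset.sum_congr rfl fun _ _ => by ring
    ext o o'
    rw [h]
    rcases o with _ | j <;> rcases o' with _ | k
    · simp [e, w, hd0]
    · simp [e, w, hlam.traceless]
    · simp [e, w, hlam.traceless]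
    · simp [e, w, hlam.orthonormal, one_apply]
  have hcard : Fintype.card (Option (Fin (d ^ 2 - 1))) = Fintype.card (Fin d × Fin d) := by
    have : 0 < d ^ 2 := by positivity
    simp only [Fintype.card_option, Fintype.card_fin, Fintype.card_prod]
    rw [← sq]; omega
  have hBA : B * A = 1 := (mul_eq_one_comm_of_card_eq (R := ℂ) (eq := hcard)).1 hAB
  ext i j
  have h := congrFun (congrArg (fun M => M *ᵥ fun p : Fin d × Fin d => Y p.1 p.2) hBA) (i, j)
  simp only [one_mulVec, ← mulVec_mulVec] at h
  rw [← h]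
  have hA (o) : (A *ᵥ fun p : Fin d × Fin d => Y p.1 p.2) o = (e o * Y).trace := by
    simp only [A, mulVec, dotProduct, of_apply, trace, diag_apply, mul_apply,
      Fintype.sum_prod_type]
    rw [Finset.sum_comm]
  simp only [mulVec, dotProduct] at hA ⊢
  simp only [hA, Fintype.sum_option, B, of_apply, e, w, Option.elim, Matrix.add_apply, Matrix.smul_apply,
    Matrix.sum_apply, smul_eq_mul, one_mul]
  congr 1
  · ring
  · exact Finset.sum_congr rfl fun _ _ => by ring

/-- A linear functional on `M_d(ℂ)` is determined by its values at `1` and at the generators. -/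
theorem IsGenerators.linearMap_ext (hlam : IsGenerators lam) (hd : 0 < d) {f g : Op d →ₗ[ℂ] ℂ}
    (h1 : f 1 = g 1) (h : ∀ k, f (lam k) = g (lam k)) : f = g := by
  ext1 Y
  rw [hlam.expansion hd Y]
  simp [h1, h]

theorem trace_mul_kronecker_one (ρ : Op2 d) (A : Op d) :
    (ρ * (A ⊗ₖ (1 : Op d))).trace = (ptraceB ρ * A).trace := by
  simp only [trace, diag_apply, mul_apply, Fintype.sum_prod_type, kroneckerMap_apply, ptraceB,
    of_apply, one_apply, mul_ite, mul_one, mul_zero, Finset.sum_ite_eq', Finset.mem_univ, if_true,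
    Finset.sum_mul]
  exact Finset.sum_congr rfl fun _ _ => Finset.sum_comm

theorem trace_mul_one_kronecker (ρ : Op2 d) (B : Op d) :
    (ρ * ((1 : Op d) ⊗ₖ B)).trace = (ptraceA ρ * B).trace := by
  simp only [trace, diag_apply, mul_apply, Fintype.sum_prod_type, kroneckerMap_apply, ptraceA,
    of_apply, one_apply, ite_mul, one_mul, zero_mul, mul_ite, mul_zero, Finset.sum_mul]
  simp only [Finset.sum_ite_irrel, Finset.sum_const_zero, Finset.sum_ite_eq', Finset.mem_univ,
    if_true]
  rw [Finset.sum_comm]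
  exact Finset.sum_congr rfl fun _ _ => Finset.sum_comm

/-- An operator on `ℂ^d ⊗ ℂ^d` is determined by its expectations of product operators. -/
theorem op2_ext {X Y : Op2 d} (h : ∀ A B : Op d, (X * (A ⊗ₖ B)).trace = (Y * (A ⊗ₖ B)).trace) :
    X = Y := by
  ext ⟨i, j⟩ ⟨k, l⟩
  have := h (single k i 1) (single l j 1)
  simpa [single_kronecker_single, trace_mul_single] using this

/-- The bilinear form `(A, B) ↦ tr (X (A ⊗ B))`. -/
noncomputable def expectation (X : Op2 d) : Op d →ₗ[ℂ] Op d →ₗ[ℂ] ℂ :=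
  LinearMap.mk₂ ℂ (fun A B => (X * (A ⊗ₖ B)).trace)
    (fun _ _ _ => by simp [add_kronecker, mul_add])
    (fun _ _ _ => by simp [smul_kronecker])
    (fun _ _ _ => by simp [kronecker_add, mul_add])
    (fun _ _ _ => by simp [kronecker_smul])

@[simp] theorem expectation_apply (X : Op2 d) (A B : Op d) :
    expectation X A B = (X * (A ⊗ₖ B)).trace := rfl

/-- The Bloch expansion in basis-free form: the expectations of `1 ⊗ 1`, `λ_j ⊗ 1`, `1 ⊗ λ_k` and
`λ_j ⊗ λ_k` determine an operator. -/
theorem IsGenerators.op2_ext (hlam : IsGenerators lam) (hd : 0 < d) {X Y : Op2 d}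
    (hA : ptraceA X = ptraceA Y) (hB : ptraceB X = ptraceB Y)
    (h : ∀ j k, (X * (lam j ⊗ₖ lam k)).trace = (Y * (lam j ⊗ₖ lam k)).trace) : X = Y := by
  refine QuditDiscord.op2_ext fun A B => ?_
  suffices H : expectation X = expectation Y by
    simpa using congrArg (fun f => f A B) H
  have hA1 (k : Op d) : expectation X 1 k = expectation Y 1 k := by
    simp [trace_mul_one_kronecker, hA]
  have hB1 (k : Op d) : expectation X k 1 = expectation Y k 1 := by
    simp [trace_mul_kronecker_one, hB]
  refine LinearMap.ext fun A => ?_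
  refine hlam.linearMap_ext hd (hB1 A) fun k => ?_
  have : (expectation X).flip (lam k) = (expectation Y).flip (lam k) :=
    hlam.linearMap_ext hd (hA1 _) fun j => h j k
  simpa using congrArg (fun f => f A) this

/-- `tr (A B)` is real for hermitian `A`, `B`. -/
theorem trace_mul_ofReal_re {n : Type*} [Fintype n] {A B : Matrix n n ℂ} (hA : A.IsHermitian)
    (hB : B.IsHermitian) : (((A * B).trace.re : ℝ) : ℂ) = (A * B).trace := by
  rw [← Complex.conj_eq_iff_re, starRingEnd_apply, ← trace_conjTranspose, conjTranspose_mul,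
    hA.eq, hB.eq, trace_mul_comm]

/-- The operator `d⁻² (1 + 2t (N - 1/d))`. It has maximally mixed reductions and correlation matrix
`t • K` as soon as `N` has reductions `1` and `tr (N (λ_j ⊗ λ_k)) = 2 K_{jk}`. -/
noncomputable def mixture (t : ℝ) (N : Op2 d) : Op2 d :=
  ((d : ℂ) ^ 2)⁻¹ • ((1 - 2 * (t : ℂ) / d) • (1 : Op2 d) + (2 * (t : ℂ)) • N)

theorem ptraceA_mixture (hd : 0 < d) (t : ℝ) {N : Op2 d} (hN : ptraceA N = 1) :
    ptraceA (mixture t N) = (d : ℂ)⁻¹ • (1 : Op d) := by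
  have hd0 : (d : ℂ) ≠ 0 := by exact_mod_cast hd.ne'
  ext i j
  have := congrFun (congrFun hN i) j
  simp only [ptraceA, mixture, of_apply, Matrix.smul_apply, Matrix.add_apply, smul_eq_mul, ← Finset.mul_sum,
    Finset.sum_add_distrib] at this ⊢
  rw [this]
  by_cases h : i = j <;> simp [one_apply, h]
  field_simp
  ring

theorem ptraceB_mixture (hd : 0 < d) (t : ℝ) {N : Op2 d} (hN : ptraceB N = 1) :
    ptraceB (mixture t N) = (d : ℂ)⁻¹ • (1 : Op d) := by
  have hd0 : (d : ℂ) ≠ 0 := by exact_mod_cast hd.ne'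
  ext i j
  have := congrFun (congrFun hN i) j
  simp only [ptraceB, mixture, of_apply, Matrix.smul_apply, Matrix.add_apply, smul_eq_mul, ← Finset.mul_sum,
    Finset.sum_add_distrib] at this ⊢
  rw [this]
  by_cases h : i = j <;> simp [one_apply, h]
  field_simp
  ring

theorem IsGenerators.trace_mixture_mul (hlam : IsGenerators lam) (t : ℝ) (N : Op2 d)
    (j k : Fin (d ^ 2 - 1)) : (mixture t N * (lam j ⊗ₖ lam k)).trace =
      ((d : ℂ) ^ 2)⁻¹ * (2 * t) * (N * (lam j ⊗ₖ lam k)).trace := by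
  simp [mixture, add_mul, trace_kronecker, hlam.traceless, mul_assoc]

/-- The only candidate for a locally maximally mixed state with correlation matrix `t • K` is
`mixture t N`. -/
theorem IsGenerators.mem_lmmStates_iff (hlam : IsGenerators lam) (hd : 0 < d) (t : ℝ)
    {N : Op2 d} {K : Matrix (Fin (d ^ 2 - 1)) (Fin (d ^ 2 - 1)) ℝ}
    (hA : ptraceA N = 1) (hB : ptraceB N = 1)
    (hK : ∀ j k, (N * (lam j ⊗ₖ lam k)).trace = ((2 * K j k : ℝ) : ℂ)) {ρ : Op2 d} :
    ρ ∈ lmmStates lam (t • K) ↔ ρ = mixture t N ∧ IsState (mixture t N) := by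
  have hd0 : (d : ℂ) ≠ 0 := by exact_mod_cast hd.ne'
  have hd1 : (d : ℝ) ≠ 0 := by exact_mod_cast hd.ne'
  have hcorr (j k) : (mixture t N * (lam j ⊗ₖ lam k)).trace =
      (((d : ℝ) ^ 2)⁻¹ * (2 * t) * (2 * K j k) : ℝ) := by
    rw [hlam.trace_mixture_mul, hK]
    push_cast
    ring
  constructor
  · rintro ⟨hs, ⟨hρA, hρB⟩, hρK⟩
    have : ρ = mixture t N := by
      refine hlam.op2_ext hd ?_ ?_ fun j k => ?_
      · rw [hρA, ptraceA_mixture hd t hA]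
      · rw [hρB, ptraceB_mixture hd t hB]
      · have hherm : (lam j ⊗ₖ lam k).IsHermitian := by
          rw [IsHermitian, conjTranspose_kronecker, (hlam.hermitian j).eq, (hlam.hermitian k).eq]
        have h := congrFun (congrFun hρK j) k
        simp only [correlationMatrix, of_apply, Matrix.smul_apply, smul_eq_mul] at h
        rw [hcorr, ← trace_mul_ofReal_re hs.1.1 hherm]
        congr 1
        field_simp
        linarith
    exact ⟨this, this ▸ hs⟩
  · rintro ⟨rfl, hs⟩
    refine ⟨hs, ⟨ptraceA_mixture hd t hA, ptraceB_mixture hd t hB⟩, ?_⟩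
    ext j k
    simp only [correlationMatrix, of_apply, hcorr, Complex.ofReal_re, Matrix.smul_apply, smul_eq_mul]
    field_simp
    ring

end Generators
/-! ### The swap and the maximally entangled projection -/

section Operators

variable {d : ℕ}

/-- The swap operator `x ⊗ y ↦ y ⊗ x`. -/
def swap (d : ℕ) : Op2 d := of fun p q => if p.1 = q.2 ∧ p.2 = q.1 then 1 else 0

/-- The unnormalized maximally entangled vector `∑ i, e_i ⊗ e_i`. -/
def entVec (d : ℕ) : Fin d × Fin d → ℂ := fun p => if p.1 = p.2 then 1 else 0

/-- The operator `∑ i j, |i i⟩⟨j j|`: `d` times the maximally entangled projection, and the partial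
transpose of the swap. -/
def ent (d : ℕ) : Op2 d := vecMulVec (entVec d) (entVec d)

theorem swap_mul_kronecker (A B : Op d) : swap d * (A ⊗ₖ B) = (B ⊗ₖ A) * swap d := by
  ext ⟨i, j⟩ ⟨k, l⟩
  simp [swap, mul_apply, Fintype.sum_prod_type, ite_and, mul_comm]

theorem swap_mul_swap : swap d * swap d = 1 := by
  ext ⟨i, j⟩ ⟨k, l⟩
  simp [swap, mul_apply, Fintype.sum_prod_type, ite_and, one_apply]

theorem swap_isHermitian : (swap d).IsHermitian := by
  ext ⟨i, j⟩ ⟨k, l⟩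
  simp [swap, conjTranspose_apply, apply_ite, eq_comm, and_comm]

theorem trace_swap_mul (A B : Op d) : (swap d * (A ⊗ₖ B)).trace = (A * B).trace := by
  rw [swap_mul_kronecker, trace_mul_comm A B]
  simp [swap, trace, mul_apply, Fintype.sum_prod_type, ite_and]

theorem trace_ent_mul (A B : Op d) : (ent d * (A ⊗ₖ B)).trace = (Aᵀ * B).trace := by
  simp [ent, entVec, trace, mul_apply, Fintype.sum_prod_type, vecMulVec_apply]

theorem ent_isHermitian : (ent d).IsHermitian := by
  ext p q
  by_cases h : p.1 = p.2 <;> by_cases h' : q.1 = q.2 <;>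
    simp [ent, entVec, conjTranspose_apply, vecMulVec_apply, h, h']

theorem entVec_dotProduct_self : entVec d ⬝ᵥ entVec d = d := by
  simp [entVec, dotProduct, Fintype.sum_prod_type]

theorem ent_mul_ent : ent d * ent d = (d : ℂ) • ent d := by
  rw [ent, vecMulVec_mul_vecMulVec, entVec_dotProduct_self, vecMulVec_smul]

theorem trace_swap : (swap d).trace = d := by
  simpa using trace_swap_mul (1 : Op d) 1

theorem trace_ent : (ent d).trace = d := by
  simpa using trace_ent_mul (1 : Op d) 1

/-- The swap commutes with `Y ⊗ Y`. -/
theorem swap_conj {Y : Op d} (hY : Y ∈ unitaryGroup (Fin d) ℂ) :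
    (Y ⊗ₖ Y) * swap d * (Y ⊗ₖ Y)ᴴ = swap d := by
  rw [← swap_mul_kronecker, mul_assoc, ← star_eq_conjTranspose,
    mem_unitaryGroup_iff.1 (kronecker_mem_unitary hY hY), mul_one]

/-- The maximally entangled vector is fixed by `Y ⊗ conj Y`. -/
theorem ent_conj {Y : Op d} (hY : Y ∈ unitaryGroup (Fin d) ℂ) :
    (Y ⊗ₖ Y.map star) * ent d * (Y ⊗ₖ Y.map star)ᴴ = ent d := by
  have h : (Y ⊗ₖ Y.map star) *ᵥ entVec d = entVec d := by
    ext ⟨i, j⟩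
    have := congrFun (congrFun (mem_unitaryGroup_iff.1 hY) i) j
    simpa [mul_apply, one_apply, mulVec, dotProduct, entVec, Fintype.sum_prod_type] using this
  have h' : entVec d ᵥ* (Y ⊗ₖ Y.map star)ᴴ = entVec d := by
    have hs : star (entVec d) = entVec d := by
      ext p; simp [entVec, apply_ite]
    rw [← hs, ← star_mulVec, h]
  rw [ent, mul_vecMulVec, vecMulVec_mul, h, h']

theorem trace_conj_mul_kronecker (M : Op2 d) (U W A B : Op d) :
    (((U ⊗ₖ W) * M * (U ⊗ₖ W)ᴴ) * (A ⊗ₖ B)).trace =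
      (M * ((Uᴴ * A * U) ⊗ₖ (Wᴴ * B * W))).trace := by
  rw [mul_kronecker_mul, mul_kronecker_mul, conjTranspose_kronecker, mul_assoc, mul_assoc,
    trace_mul_comm]
  simp only [mul_assoc]

theorem trace_unitary_conj {U : Op d} (hU : U ∈ unitaryGroup (Fin d) ℂ) (A : Op d) :
    (Uᴴ * A * U).trace = A.trace := by
  rw [trace_mul_comm, ← mul_assoc, ← star_eq_conjTranspose, mem_unitaryGroup_iff.1 hU, one_mul]

theorem ptraceA_swap : ptraceA (swap d) = 1 := by
  rw [ext_iff_trace_mul_right]; intro x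
  rw [← trace_mul_one_kronecker, trace_swap_mul]

theorem ptraceB_swap : ptraceB (swap d) = 1 := by
  rw [ext_iff_trace_mul_right]; intro x
  rw [← trace_mul_kronecker_one, trace_swap_mul, mul_one, one_mul]

theorem ptraceA_ent : ptraceA (ent d) = 1 := by
  rw [ext_iff_trace_mul_right]; intro x
  rw [← trace_mul_one_kronecker, trace_ent_mul, transpose_one]

theorem ptraceB_ent : ptraceB (ent d) = 1 := by
  rw [ext_iff_trace_mul_right]; intro x
  rw [← trace_mul_kronecker_one, trace_ent_mul, mul_one, one_mul, trace_transpose]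

theorem ptraceA_conj {M : Op2 d} (hM : ptraceA M = 1) {U W : Op d}
    (hU : U ∈ unitaryGroup (Fin d) ℂ) (hW : W ∈ unitaryGroup (Fin d) ℂ) :
    ptraceA ((U ⊗ₖ W) * M * (U ⊗ₖ W)ᴴ) = 1 := by
  rw [ext_iff_trace_mul_right]; intro x
  rw [← trace_mul_one_kronecker, trace_conj_mul_kronecker, mul_one, ← star_eq_conjTranspose U,
    mem_unitaryGroup_iff'.1 hU, trace_mul_one_kronecker, hM, one_mul, one_mul,
    trace_unitary_conj hW]

theorem ptraceB_conj {M : Op2 d} (hM : ptraceB M = 1) {U W : Op d}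
    (hU : U ∈ unitaryGroup (Fin d) ℂ) (hW : W ∈ unitaryGroup (Fin d) ℂ) :
    ptraceB ((U ⊗ₖ W) * M * (U ⊗ₖ W)ᴴ) = 1 := by
  rw [ext_iff_trace_mul_right]; intro x
  rw [← trace_mul_kronecker_one, trace_conj_mul_kronecker, mul_one, ← star_eq_conjTranspose W,
    mem_unitaryGroup_iff'.1 hW, trace_mul_kronecker_one, hM, one_mul, one_mul,
    trace_unitary_conj hU]

end Operators

/-! ### Positivity -/

section Positivity

open scoped ComplexOrder

/-- A projection and its complement, both nonzero, have nonnegative coefficients in a positive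
semidefinite combination. -/
theorem posSemidef_projection_iff {n : Type*} [Fintype n] [DecidableEq n] {P : Matrix n n ℂ}
    (hP : P.IsHermitian) (hPP : P * P = P) (h0 : 0 < P.trace) (h1 : 0 < (1 - P).trace) (a b : ℝ) :
    ((a : ℂ) • P + (b : ℂ) • (1 - P)).PosSemidef ↔ 0 ≤ a ∧ 0 ≤ b := by
  have hQ : (1 - P).IsHermitian := isHermitian_one.sub hP
  have hQQ : (1 - P) * (1 - P) = 1 - P := by
    rw [mul_sub, sub_mul, sub_mul, hPP]; simp
  have hPQ : P * (1 - P) = 0 := by rw [mul_sub, hPP, mul_one, sub_self]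
  have hQP : (1 - P) * P = 0 := by rw [sub_mul, hPP, one_mul, sub_self]
  have key {R : Matrix n n ℂ} {c : ℝ} (hT : 0 < R.trace)
      (h : ((c : ℂ) • R).PosSemidef) : 0 ≤ c := by
    have := h.trace_nonneg
    rw [trace_smul, smul_eq_mul] at this
    obtain ⟨hre, him⟩ := Complex.pos_iff.1 hT
    have h2 := (Complex.nonneg_iff.1 this).1
    rw [Complex.re_ofReal_mul] at h2
    exact nonneg_of_mul_nonneg_left h2 hre
  constructor
  · intro h
    refine ⟨key h0 ?_, key h1 ?_⟩
    · have := h.mul_mul_conjTranspose_same P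
      rwa [hP.eq, mul_add, add_mul, Matrix.mul_smul, Matrix.mul_smul, hPP, hPQ, Matrix.smul_mul, Matrix.smul_mul, hPP,
        zero_mul, smul_zero, add_zero] at this
    · have := h.mul_mul_conjTranspose_same (1 - P)
      rwa [hQ.eq, mul_add, add_mul, Matrix.mul_smul, Matrix.mul_smul, hQQ, hQP, Matrix.smul_mul, Matrix.smul_mul, hQQ,
        zero_mul, smul_zero, zero_add] at this
  · rintro ⟨ha, hb⟩
    have psd {R : Matrix n n ℂ} (hR : R.IsHermitian) (hRR : R * R = R) : R.PosSemidef := by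
      have := posSemidef_conjTranspose_mul_self R
      rwa [hR.eq, hRR] at this
    exact ((psd hP hPP).smul (by exact_mod_cast ha)).add ((psd hQ hQQ).smul (by exact_mod_cast hb))

end Positivity

/-! ### Trace norm and spectrum under unitary conjugation -/

section Conjugation

variable {d : ℕ}

open scoped ComplexOrder MatrixOrder

theorem traceNorm_eq_of_mul_self {X B : Op2 d} (hB : B.PosSemidef) (h : B * B = Xᴴ * X) :
    traceNorm X = B.trace.re := by
  rw [traceNorm, CFC.abs, star_eq_conjTranspose, CFC.sqrt_unique (b := B) h hB.nonneg]

theorem traceNorm_smul_conj (s : ℝ) {L T B : Op2 d} (hL : L ∈ unitaryGroup (Fin d × Fin d) ℂ)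
    (hB : B.PosSemidef) (h : B * B = Tᴴ * T) :
    traceNorm ((s : ℂ) • (L * T * Lᴴ)) = |s| * B.trace.re := by
  have hL' : Lᴴ * L = 1 := mem_unitaryGroup_iff'.1 hL
  have hc (A C : Op2 d) : (L * A * Lᴴ) * (L * C * Lᴴ) = L * (A * C) * Lᴴ := by
    calc _ = L * A * (Lᴴ * L) * C * Lᴴ := by noncomm_ring
      _ = _ := by rw [hL']; noncomm_ring
  rw [traceNorm_eq_of_mul_self (B := ((|s| : ℝ) : ℂ) • (L * B * Lᴴ))]
  · rw [trace_smul, trace_mul_comm, ← mul_assoc, hL', one_mul, smul_eq_mul, Complex.re_ofReal_mul]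
  · exact (hB.mul_mul_conjTranspose_same L).smul (by exact_mod_cast abs_nonneg s)
  · have hT : (L * T * Lᴴ)ᴴ = L * Tᴴ * Lᴴ := by simp [mul_assoc]
    rw [conjTranspose_smul, hT]
    simp only [Matrix.smul_mul, Matrix.mul_smul, smul_smul, hc, h]
    congr 1
    rw [← Complex.ofReal_mul, abs_mul_abs_self]
    simp

theorem charpoly_smul_conj (s : ℝ) {L : Op2 d} (T : Op2 d)
    (hL : L ∈ unitaryGroup (Fin d × Fin d) ℂ) :
    (((s : ℂ) • (L * T * Lᴴ)) * ((s : ℂ) • (L * T * Lᴴ))ᴴ).charpoly =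
      (((s : ℂ) ^ 2) • (T * Tᴴ)).charpoly := by
  have hL' : Lᴴ * L = 1 := mem_unitaryGroup_iff'.1 hL
  have : ((s : ℂ) • (L * T * Lᴴ)) * ((s : ℂ) • (L * T * Lᴴ))ᴴ =
      L * ((((s : ℂ) ^ 2) • (T * Tᴴ)) * Lᴴ) := by
    simp only [conjTranspose_smul, conjTranspose_mul, conjTranspose_conjTranspose, Matrix.smul_mul,
      Matrix.mul_smul, smul_smul]
    congr 1
    · simp [sq]
    · calc _ = L * T * (Lᴴ * L) * Tᴴ * Lᴴ := by noncomm_ring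
        _ = _ := by rw [hL']; noncomm_ring
  rw [this, charpoly_mul_comm, mul_assoc, hL', mul_one]

end Conjugation
/-! ### Local projective measurements -/

section Measurements

variable {d : ℕ}

open scoped ComplexOrder

/-- The measurement in the standard basis. -/
noncomputable def standardMeasurement (d : ℕ) : Measurement d where
  proj k := diagonal (Pi.single k 1)
  hermitian k := by
    rw [IsHermitian, diagonal_conjTranspose]
    congr 1
    ext i
    by_cases h : i = k <;> simp [h]
  mul_proj j k := by
    rw [diagonal_mul_diagonal]
    split_ifs with h
    · subst h
      congr 1
      ext i
      by_cases h : i = j <;> simp [h]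
    · rw [← diagonal_zero]
      congr 1
      ext i
      by_cases hi : i = j
      · subst hi; simp [h]
      · simp [hi]
  rank_one k := by
    rw [rank_diagonal, Fintype.card_eq_one_iff]
    refine ⟨⟨k, by simp⟩, fun ⟨i, hi⟩ => ?_⟩
    by_contra h
    exact hi (Pi.single_eq_of_ne (fun h' => h (Subtype.ext h')) 1)
  sum_proj := by
    ext i j
    simp [Matrix.sum_apply, diagonal_apply, one_apply, Pi.single_apply]

/-- Every measurement is the standard one in a suitable orthonormal basis. -/
theorem Measurement.exists_unitary (P : Measurement d) :
    ∃ V ∈ unitaryGroup (Fin d) ℂ, ∀ k, P.proj k * V = V * diagonal (Pi.single k 1) := by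
  -- A unit vector in the range of each projector.
  have hex (k : Fin d) : ∃ v : Fin d → ℂ, P.proj k *ᵥ v = v ∧ star v ⬝ᵥ v = 1 := by
    have hne : P.proj k ≠ 0 := fun h => by simpa [h] using P.rank_one k
    obtain ⟨x, hx⟩ : ∃ x, P.proj k *ᵥ x ≠ 0 := by
      by_contra! h
      exact hne (ext_of_mulVec_single fun i => by simp only [h, zero_mulVec])
    set y := P.proj k *ᵥ x with hy
    have hyy : P.proj k *ᵥ y = y := by rw [hy, mulVec_mulVec, P.mul_proj, if_pos rfl]
    have hpos : 0 < star y ⬝ᵥ y := dotProduct_star_self_pos_iff.2 hx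
    obtain ⟨hre, him⟩ := Complex.pos_iff.1 hpos
    set r := (star y ⬝ᵥ y).re
    have hr : star y ⬝ᵥ y = (r : ℂ) := Complex.ext rfl him.symm
    refine ⟨(((√r)⁻¹ : ℝ) : ℂ) • y, by rw [mulVec_smul, hyy], ?_⟩
    rw [star_smul, smul_dotProduct, dotProduct_smul, hr]
    simp only [smul_eq_mul, Complex.star_def, Complex.conj_ofReal]
    rw [← Complex.ofReal_mul, ← Complex.ofReal_mul, ← Complex.ofReal_one]
    congr 1
    have := Real.mul_self_sqrt hre.le
    have h0 : √r ≠ 0 := (Real.sqrt_pos.2 hre).ne'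
    field_simp
    rw [sq, this]
  choose v hv hvv using hex
  have hPv (j k) : P.proj j *ᵥ v k = if j = k then v k else 0 := by
    rw [← hv k, mulVec_mulVec, P.mul_proj]
    split_ifs with h
    · rfl
    · rw [zero_mulVec]
  refine ⟨(of v)ᵀ, ?_, fun k => ?_⟩
  · rw [mem_unitaryGroup_iff', star_eq_conjTranspose]
    ext j k
    have h : ((of v)ᵀᴴ * (of v)ᵀ) j k = star (v j) ⬝ᵥ v k := rfl
    rw [h, one_apply]
    split_ifs with hjk
    · rw [hjk, hvv]
    · rw [← hv j, star_mulVec, (P.hermitian j).eq, ← dotProduct_mulVec, hPv, if_neg hjk,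
        dotProduct_zero]
  · ext i j
    have h := congrFun (hPv k j) i
    rw [mul_diagonal]
    refine Eq.trans (show _ = (P.proj k *ᵥ v j) i from rfl) (h.trans ?_)
    by_cases hkj : k = j
    · subst hkj; simp
    · simp [hkj, Ne.symm hkj]

/-- The part of an operator that is off-diagonal on the first qudit: what the standard measurement
removes. -/
def offDiag (M : Op2 d) : Op2 d := of fun p q => if p.1 = q.1 then 0 else M p q

theorem sum_diagonal_conj (M : Op2 d) :
    ∑ k : Fin d, ((diagonal (Pi.single k 1) : Op d) ⊗ₖ (1 : Op d)) * M *
      ((diagonal (Pi.single k 1) : Op d) ⊗ₖ (1 : Op d)) = M - offDiag M := by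
  ext p q
  simp only [← diagonal_one, diagonal_kronecker_diagonal, Matrix.sum_apply, mul_diagonal,
    diagonal_mul, offDiag, Matrix.sub_apply, of_apply, mul_one, Pi.single_apply]
  by_cases h : p.1 = q.1 <;> simp [h]

/-- In a product basis adapted to the measurement, the disturbance is the off-diagonal part. -/
theorem disturbance_conj (P : Measurement d) {V : Op d}
    (hP : ∀ k, P.proj k * V = V * diagonal (Pi.single k 1)) (Y : Op d) (M : Op2 d) :
    disturbance P ((V ⊗ₖ Y) * M * (V ⊗ₖ Y)ᴴ) = (V ⊗ₖ Y) * offDiag M * (V ⊗ₖ Y)ᴴ := by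
  have h1 (k) : (P.proj k ⊗ₖ (1 : Op d)) * (V ⊗ₖ Y) =
      (V ⊗ₖ Y) * ((diagonal (Pi.single k 1) : Op d) ⊗ₖ (1 : Op d)) := by
    rw [← mul_kronecker_mul, ← mul_kronecker_mul, hP, one_mul, mul_one]
  have hD (k : Fin d) : ((diagonal (Pi.single k 1) : Op d))ᴴ = diagonal (Pi.single k 1) :=
    (standardMeasurement d).hermitian k
  have h2 (k) : (V ⊗ₖ Y)ᴴ * (P.proj k ⊗ₖ (1 : Op d)) =
      ((diagonal (Pi.single k 1) : Op d) ⊗ₖ (1 : Op d)) * (V ⊗ₖ Y)ᴴ := by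
    have := congrArg conjTranspose (h1 k)
    simpa only [conjTranspose_mul, conjTranspose_kronecker, (P.hermitian k).eq, hD,
      conjTranspose_one] using this
  have h3 : P.onA ((V ⊗ₖ Y) * M * (V ⊗ₖ Y)ᴴ) = (V ⊗ₖ Y) * (M - offDiag M) * (V ⊗ₖ Y)ᴴ := by
    rw [← sum_diagonal_conj, Measurement.onA, Finset.mul_sum, Finset.sum_mul]
    refine Finset.sum_congr rfl fun k _ => ?_
    calc _ = ((P.proj k ⊗ₖ (1 : Op d)) * (V ⊗ₖ Y)) * M *
          ((V ⊗ₖ Y)ᴴ * (P.proj k ⊗ₖ (1 : Op d))) := by noncomm_ring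
      _ = _ := by rw [h1, h2]; noncomm_ring
  rw [disturbance, h3]
  noncomm_ring

theorem Measurement.onA_one (P : Measurement d) : P.onA 1 = 1 := by
  simp only [onA, mul_one, ← mul_kronecker_mul, P.mul_proj, if_true]
  rw [← one_kronecker_one, ← P.sum_proj]
  ext p q
  simp [Matrix.sum_apply, Finset.sum_mul]

theorem disturbance_mixture (P : Measurement d) (t : ℝ) (N : Op2 d) :
    disturbance P (mixture t N) = ((2 * t / (d : ℝ) ^ 2 : ℝ) : ℂ) • disturbance P N := by
  have h : P.onA (mixture t N) =
      ((d : ℂ) ^ 2)⁻¹ • ((1 - 2 * (t : ℂ) / d) • P.onA 1 + (2 * (t : ℂ)) • P.onA N) := by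
    simp only [Measurement.onA, mixture, Finset.smul_sum, ← Finset.sum_add_distrib, mul_add,
      add_mul, Matrix.mul_smul, Matrix.smul_mul, smul_add]
  rw [disturbance, h, P.onA_one, mixture, disturbance]
  push_cast
  module

/-- Trace norm and spectrum of the disturbance of `mixture t N`, if in every measured basis `N` is
unitarily equivalent to the same operator `M`. -/
theorem discord_mixture {M N B : Op2 d}
    (hMN : ∀ V ∈ unitaryGroup (Fin d) ℂ, ∃ Y ∈ unitaryGroup (Fin d) ℂ,
      N = (V ⊗ₖ Y) * M * (V ⊗ₖ Y)ᴴ)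
    (hB : B.PosSemidef) (h : B * B = (offDiag M)ᴴ * offDiag M) (t : ℝ) :
    (IsLeast (discordValues (mixture t N)) (discord (mixture t N)) ∧
      discord (mixture t N) =
        (d : ℝ) / (2 * ((d : ℝ) - 1)) * (|2 * t / (d : ℝ) ^ 2| * B.trace.re)) ∧
    ∀ P : Measurement d, (disturbanceSq P (mixture t N)).charpoly =
      (((2 * (t : ℂ) / (d : ℂ) ^ 2) ^ 2) • (offDiag M * (offDiag M)ᴴ)).charpoly := by
  have key (P : Measurement d) : ∃ L ∈ unitaryGroup (Fin d × Fin d) ℂ,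
      disturbance P (mixture t N) =
        ((2 * t / (d : ℝ) ^ 2 : ℝ) : ℂ) • (L * offDiag M * Lᴴ) := by
    obtain ⟨V, hV, hP⟩ := P.exists_unitary
    obtain ⟨Y, hY, rfl⟩ := hMN V hV
    exact ⟨V ⊗ₖ Y, kronecker_mem_unitary hV hY, by
      rw [disturbance_mixture, disturbance_conj P hP]⟩
  have hval : discordValues (mixture t N) =
      {(d : ℝ) / (2 * ((d : ℝ) - 1)) * (|2 * t / (d : ℝ) ^ 2| * B.trace.re)} := by
    have : Nonempty (Measurement d) := ⟨standardMeasurement d⟩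
    rw [discordValues, ← Set.range_const (ι := Measurement d)]
    congr 1
    ext P
    obtain ⟨L, hL, h'⟩ := key P
    rw [h', traceNorm_smul_conj _ hL hB h]
  refine ⟨?_, fun P => ?_⟩
  · rw [discord, hval, csInf_singleton]
    exact ⟨isLeast_singleton, rfl⟩
  · obtain ⟨L, hL, h'⟩ := key P
    rw [disturbanceSq, h', charpoly_smul_conj _ _ hL]
    push_cast
    rfl

end Measurements

/-! ### The off-diagonal part of the swap -/

section SwapPart

open Polynomial
open scoped ComplexOrder

variable {d : ℕ}

/-- The coordinate projection onto the span of the `e_i ⊗ e_j` with `i ≠ j`. -/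
def offDiagProj (d : ℕ) : Op2 d := diagonal fun p => if p.1 = p.2 then 0 else 1

theorem offDiagProj_mul_self : offDiagProj d * offDiagProj d = offDiagProj d := by
  simp [offDiagProj, diagonal_mul_diagonal]

theorem offDiag_swap_mul_self : offDiag (swap d) * offDiag (swap d) = offDiagProj d := by
  have h1 : offDiag (swap d) = offDiagProj d * swap d := by
    ext ⟨i, j⟩ ⟨k, l⟩
    rw [offDiagProj, diagonal_mul]
    simp only [offDiag, swap, of_apply]
    split_ifs <;> grind
  have h2 : offDiag (swap d) = swap d * offDiagProj d := by
    ext ⟨i, j⟩ ⟨k, l⟩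
    rw [offDiagProj, mul_diagonal]
    simp only [offDiag, swap, of_apply]
    split_ifs <;> grind
  calc _ = (offDiagProj d * swap d) * (swap d * offDiagProj d) := by rw [← h1, ← h2]
    _ = offDiagProj d * (swap d * swap d) * offDiagProj d := by noncomm_ring
    _ = _ := by rw [swap_mul_swap, mul_one, offDiagProj_mul_self]

theorem offDiag_isHermitian {M : Op2 d} (hM : M.IsHermitian) : (offDiag M).IsHermitian := by
  ext p q
  have := hM.apply p q
  simp only [conjTranspose_apply, offDiag, of_apply, eq_comm (a := q.1)]
  split_ifs
  · simp
  · exact this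

theorem posSemidef_offDiagProj : (offDiagProj d).PosSemidef :=
  posSemidef_diagonal_iff.2 fun p => by split_ifs <;> simp

theorem trace_offDiagProj : (offDiagProj d).trace = d * (d - 1) := by
  have h (p : Fin d × Fin d) :
      (if p.1 = p.2 then (0 : ℂ) else 1) = 1 - if p.1 = p.2 then 1 else 0 := by
    split_ifs <;> simp
  simp only [offDiagProj, trace_diagonal, h, Finset.sum_sub_distrib, Fintype.sum_prod_type]
  simp
  ring

theorem charpoly_smul_offDiagProj (c : ℂ) :
    (c • offDiagProj d).charpoly = (X - C c) ^ (d * (d - 1)) * X ^ d := by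
  have h1 : c • offDiagProj d = diagonal fun p : Fin d × Fin d => if p.1 = p.2 then 0 else c := by
    ext p q
    by_cases h : p = q
    · subst h; simp [offDiagProj]
    · simp [offDiagProj, h]
  rw [h1, charpoly_diagonal, Fintype.prod_prod_type]
  have h2 (i : Fin d) : ∏ j, (X - C (if i = j then 0 else c)) = (X - C c) ^ (d - 1) * X := by
    rw [Fintype.prod_eq_mul_prod_compl i, Finset.prod_congr rfl (g := fun _ => X - C c)]
    · simp [Finset.card_compl, mul_comm]
    · intro j hj
      rw [if_neg]
      rintro rfl
      simp at hj
  simp only [h2, Finset.prod_const, Finset.card_univ, Fintype.card_fin, mul_pow, ← pow_mul]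
  rw [mul_comm d]

end SwapPart

/-! ### The off-diagonal part of the maximally entangled operator -/

section EntPart

open Polynomial
open scoped ComplexOrder

variable {d : ℕ}

/-- The isometry `e_i ↦ e_i ⊗ e_i`. -/
def diagEmb (d : ℕ) : Matrix (Fin d × Fin d) (Fin d) ℂ := of fun p i => if p = (i, i) then 1 else 0

/-- The matrix all of whose entries are `1`. -/
def allOnes (d : ℕ) : Op d := vecMulVec 1 1

theorem allOnes_mul_self : allOnes d * allOnes d = (d : ℂ) • allOnes d := by
  rw [allOnes, vecMulVec_mul_vecMulVec, vecMulVec_smul]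
  simp

theorem diagEmb_isometry : (diagEmb d)ᴴ * diagEmb d = 1 := by
  ext i j
  by_cases h : i = j
  · simp [diagEmb, mul_apply, one_apply, apply_ite, h]
  · simp [diagEmb, mul_apply, apply_ite, h, Ne.symm h]

theorem offDiag_ent : offDiag (ent d) = diagEmb d * (allOnes d - 1) * (diagEmb d)ᴴ := by
  ext ⟨i, j⟩ ⟨k, l⟩
  simp only [mul_apply, diagEmb, of_apply, conjTranspose_apply, Prod.mk.injEq, offDiag, ent, entVec,
    vecMulVec_apply, allOnes, Matrix.sub_apply, one_apply, Pi.one_apply, ite_and]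
  by_cases h : i = j
  · subst h
    by_cases h' : k = l
    · subst h'
      by_cases h'' : i = k <;> simp [h'', apply_ite]
    · have : ∀ x, ¬ (k = x ∧ l = x) := fun x hx => h' (hx.1.trans hx.2.symm)
      simp [h', ← ite_and, this]
  · have : ∀ x, ¬ (i = x ∧ j = x) := fun x hx => h (hx.1.trans hx.2.symm)
    simp [h, ← ite_and, this]

theorem diagEmb_conj_mul (A B : Op d) :
    (diagEmb d * A * (diagEmb d)ᴴ) * (diagEmb d * B * (diagEmb d)ᴴ) =
      diagEmb d * (A * B) * (diagEmb d)ᴴ := by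
  calc _ = diagEmb d * A * ((diagEmb d)ᴴ * diagEmb d) * B * (diagEmb d)ᴴ := by
        simp only [Matrix.mul_assoc]
    _ = _ := by rw [diagEmb_isometry]; simp only [Matrix.mul_assoc, Matrix.one_mul]

/-- On the span of the `e_i ⊗ e_i`, `(J - 1)² = 1 + (d - 2) J` because `J² = d J`. -/
theorem offDiag_ent_mul_self : offDiag (ent d) * offDiag (ent d) =
    diagEmb d * (1 + ((d : ℂ) - 2) • allOnes d) * (diagEmb d)ᴴ := by
  rw [offDiag_ent, diagEmb_conj_mul]
  congr 2
  rw [mul_sub, sub_mul, allOnes_mul_self]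
  simp only [mul_one, one_mul]
  module

/-- The modulus `|J - 1| = 1 + ((d - 2) / d) J` of the off-diagonal part of `ent d`; it has the
eigenvalue `d - 1` on the constant vector and `1` on its complement. -/
noncomputable def absOffDiagEnt (d : ℕ) : Op2 d :=
  diagEmb d * (1 + (((d : ℂ) - 2) / d) • allOnes d) * (diagEmb d)ᴴ

theorem absOffDiagEnt_mul_self (hd : 0 < d) :
    absOffDiagEnt d * absOffDiagEnt d = offDiag (ent d) * offDiag (ent d) := by
  have hd0 : (d : ℂ) ≠ 0 := by exact_mod_cast hd.ne'
  rw [absOffDiagEnt, diagEmb_conj_mul, offDiag_ent_mul_self]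
  congr 2
  simp only [mul_add, add_mul, Matrix.mul_smul, Matrix.smul_mul, allOnes_mul_self, mul_one, one_mul,
    smul_smul]
  rw [add_assoc, ← add_smul, ← add_smul]
  congr 2
  field_simp
  ring

theorem posSemidef_absOffDiagEnt (hd : 2 ≤ d) : (absOffDiagEnt d).PosSemidef := by
  refine PosSemidef.mul_mul_conjTranspose_same (PosSemidef.one.add (PosSemidef.smul ?_ ?_)) _
  · simpa [allOnes] using posSemidef_vecMulVec_self_star (1 : Fin d → ℂ)
  · have h : ((d : ℂ) - 2) / d = (((d : ℝ) - 2) / d : ℝ) := by push_cast; rfl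
    have h2 : (2 : ℝ) ≤ d := by exact_mod_cast hd
    rw [h]
    exact_mod_cast div_nonneg (sub_nonneg.2 h2) (by positivity)

theorem trace_absOffDiagEnt (hd : 0 < d) : (absOffDiagEnt d).trace = 2 * ((d : ℂ) - 1) := by
  have hd0 : (d : ℂ) ≠ 0 := by exact_mod_cast hd.ne'
  rw [absOffDiagEnt, trace_mul_comm, ← Matrix.mul_assoc, diagEmb_isometry, Matrix.one_mul]
  simp only [trace_add, trace_one, trace_smul, allOnes, trace_vecMulVec]
  simp
  field_simp
  ring

/-- Up to the kernel, this is a rank-one perturbation of the scalar matrix `c`, with eigenvalue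
`c (1 + (d - 2) d) = c (d - 1)²` on the constant vector. -/
theorem charpoly_smul_offDiag_ent (hd : 0 < d) (c : ℂ) :
    (c • (offDiag (ent d) * offDiag (ent d))).charpoly =
      (X - C (c * ((d : ℂ) - 1) ^ 2)) * (X - C c) ^ (d - 1) * X ^ (d * (d - 1)) := by
  have h1 : c • (offDiag (ent d) * offDiag (ent d)) =
      diagEmb d * ((vecMulVec ((c * ((d : ℂ) - 2)) • 1) 1 - scalar (Fin d) (-c)) * (diagEmb d)ᴴ) := by
    rw [offDiag_ent_mul_self, ← Matrix.mul_assoc, ← Matrix.smul_mul, ← Matrix.mul_smul]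
    congr 2
    rw [smul_vecMulVec, ← allOnes, scalar_apply, ← smul_one_eq_diagonal]
    module
  have hle : Fintype.card (Fin d) ≤ Fintype.card (Fin d × Fin d) := by
    simpa using Nat.le_mul_self d
  rw [h1, charpoly_mul_comm_of_le _ _ hle, Matrix.mul_assoc, diagEmb_isometry, Matrix.mul_one,
    charpoly_sub_scalar, charpoly_vecMulVec]
  obtain ⟨e, rfl⟩ : ∃ e, d = e + 1 := ⟨d - 1, by omega⟩
  have h2 : (e + 1) * (e + 1) - (e + 1) = (e + 1) * e := by
    rw [Nat.mul_succ, Nat.add_sub_cancel]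
  simp only [Fintype.card_fin, Fintype.card_prod, Nat.add_sub_cancel, h2, sub_comp, pow_comp,
    X_comp, mul_comp, C_comp, smul_dotProduct, one_dotProduct_one, smul_eq_C_mul, smul_eq_mul]
  simp only [map_neg, map_mul, map_sub, map_pow, map_natCast, map_one, map_ofNat, Nat.cast_add,
    Nat.cast_one, map_add]
  ring

end EntPart
/-! ### The two classes of states -/

section Classes

variable {d : ℕ} {lam : Fin (d ^ 2 - 1) → Op d}

open scoped ComplexOrder

theorem IsGenerators.trace_conj_mul (hlam : IsGenerators lam) (U : Op d) (j k : Fin (d ^ 2 - 1)) :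
    (Uᴴ * lam j * U * lam k).trace = ((2 * adjointMatrix lam U j k : ℝ) : ℂ) := by
  have h : (U * lam k * Uᴴ * lam j).trace = (Uᴴ * lam j * U * lam k).trace := by
    rw [Matrix.mul_assoc (U * lam k), trace_mul_comm]
    simp only [Matrix.mul_assoc]
  have hU : (U * lam k * Uᴴ).IsHermitian := by
    simp [IsHermitian, (hlam.hermitian k).eq, Matrix.mul_assoc]
  have := trace_mul_ofReal_re hU (hlam.hermitian j)
  rw [← h, ← this, adjointMatrix, of_apply]
  push_cast
  ring

/-- `U* λ_j U = ∑ l, R(U)_{jl} λ_l`. -/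
theorem IsGenerators.conj_eq_sum (hlam : IsGenerators lam) (hd : 0 < d) {U : Op d}
    (hU : U ∈ unitaryGroup (Fin d) ℂ) (j : Fin (d ^ 2 - 1)) :
    Uᴴ * lam j * U = ∑ l, (adjointMatrix lam U j l : ℂ) • lam l := by
  rw [hlam.expansion hd (Uᴴ * lam j * U), trace_unitary_conj hU, hlam.traceless]
  simp only [zero_div, zero_smul, zero_add]
  refine Finset.sum_congr rfl fun l _ => ?_
  rw [trace_mul_comm, hlam.trace_conj_mul]
  congr 1
  push_cast
  ring

theorem IsGenerators.trace_transpose_conj_mul (hlam : IsGenerators lam) (hd : 0 < d) {U W : Op d}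
    (hU : U ∈ unitaryGroup (Fin d) ℂ) (hW : W ∈ unitaryGroup (Fin d) ℂ) (j k : Fin (d ^ 2 - 1)) :
    ((Uᴴ * lam j * U)ᵀ * (Wᴴ * lam k * W)).trace =
      ((2 * (adjointMatrix lam U * transpositionMatrix lam * (adjointMatrix lam W)ᵀ) j k : ℝ) :
        ℂ) := by
  have hT (l m) : ((lam l)ᵀ * lam m).trace = ((2 * transpositionMatrix lam l m : ℝ) : ℂ) := by
    have := trace_mul_ofReal_re (hlam.hermitian l).transpose (hlam.hermitian m)
    rw [← this, transpositionMatrix, of_apply]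
    push_cast
    ring
  rw [hlam.conj_eq_sum hd hU, hlam.conj_eq_sum hd hW, transpose_sum, mul_apply]
  simp only [transpose_smul, Finset.mul_sum, Finset.sum_mul, trace_sum, Matrix.smul_mul,
    Matrix.mul_smul, trace_smul, hT, mul_apply (M := adjointMatrix lam U), transpose_apply, smul_eq_mul]
  push_cast [Finset.mul_sum, Finset.sum_mul]
  refine Finset.sum_congr rfl fun _ _ => Finset.sum_congr rfl fun _ _ => by ring

theorem mem_unitary_of_special {U : Op d} (hU : U ∈ specialUnitaryGroup (Fin d) ℂ) :
    U ∈ unitaryGroup (Fin d) ℂ := (mem_specialUnitaryGroup_iff.1 hU).1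

/-- States of the class `𝔈^a`: the operator `N` is a rotated swap. -/
theorem IsGenerators.mem_lmmStates_adjoint_iff (hlam : IsGenerators lam) (hd : 0 < d) {U : Op d}
    (hU : U ∈ unitaryGroup (Fin d) ℂ) (t : ℝ) {ρ : Op2 d} :
    ρ ∈ lmmStates lam (t • adjointMatrix lam U) ↔
      ρ = mixture t ((U ⊗ₖ 1) * swap d * (U ⊗ₖ 1)ᴴ) ∧
        IsState (mixture t ((U ⊗ₖ 1) * swap d * (U ⊗ₖ 1)ᴴ)) := by
  refine hlam.mem_lmmStates_iff hd t (ptraceA_conj ptraceA_swap hU (one_mem _))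
    (ptraceB_conj ptraceB_swap hU (one_mem _)) fun j k => ?_
  rw [trace_conj_mul_kronecker, trace_swap_mul, conjTranspose_one, Matrix.one_mul, Matrix.mul_one,
    hlam.trace_conj_mul]

/-- States of the class `𝔈^aa`: the operator `N` is a rotated maximally entangled operator. -/
theorem IsGenerators.mem_lmmStates_transposition_iff (hlam : IsGenerators lam) (hd : 0 < d)
    {U W : Op d} (hU : U ∈ unitaryGroup (Fin d) ℂ) (hW : W ∈ unitaryGroup (Fin d) ℂ) (t : ℝ)
    {ρ : Op2 d} :
    ρ ∈ lmmStates lam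
        (t • (adjointMatrix lam U * transpositionMatrix lam * (adjointMatrix lam W)ᵀ)) ↔
      ρ = mixture t ((U ⊗ₖ W) * ent d * (U ⊗ₖ W)ᴴ) ∧
        IsState (mixture t ((U ⊗ₖ W) * ent d * (U ⊗ₖ W)ᴴ)) := by
  refine hlam.mem_lmmStates_iff hd t (ptraceA_conj ptraceA_ent hU hW)
    (ptraceB_conj ptraceB_ent hU hW) fun j k => ?_
  rw [trace_conj_mul_kronecker, trace_ent_mul, hlam.trace_transpose_conj_mul hd hU hW]

theorem isState_mixture_iff (hd : 0 < d) (t : ℝ) {N : Op2 d} (hA : ptraceA N = 1) :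
    IsState (mixture t N) ↔ (mixture t N).PosSemidef := by
  have hd0 : (d : ℂ) ≠ 0 := by exact_mod_cast hd.ne'
  refine and_iff_left ?_
  have := trace_mul_one_kronecker (mixture t N) 1
  rw [one_kronecker_one, Matrix.mul_one, Matrix.mul_one, ptraceA_mixture hd t hA] at this
  simpa [hd0] using this

theorem conj_isHermitian {M : Op2 d} (hM : M.IsHermitian) (L : Op2 d) :
    (L * M * Lᴴ).IsHermitian := by
  simp [IsHermitian, hM.eq, Matrix.mul_assoc]

theorem conj_mul_conj {L : Op2 d} (hL : L ∈ unitaryGroup (Fin d × Fin d) ℂ) (M : Op2 d) :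
    (L * M * Lᴴ) * (L * M * Lᴴ) = L * (M * M) * Lᴴ := by
  have hL' : Lᴴ * L = 1 := mem_unitaryGroup_iff'.1 hL
  calc _ = L * M * (Lᴴ * L) * M * Lᴴ := by noncomm_ring
    _ = _ := by rw [hL']; noncomm_ring

theorem trace_conj {L : Op2 d} (hL : L ∈ unitaryGroup (Fin d × Fin d) ℂ) (M : Op2 d) :
    (L * M * Lᴴ).trace = M.trace := by
  have hL' : Lᴴ * L = 1 := mem_unitaryGroup_iff'.1 hL
  rw [trace_mul_comm, ← Matrix.mul_assoc, hL', Matrix.one_mul]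

/-- The swap is an involution, with spectral projections `(1 ± F) / 2`. -/
theorem posSemidef_mixture_swap_iff (hd : 2 ≤ d) (t : ℝ) {L : Op2 d}
    (hL : L ∈ unitaryGroup (Fin d × Fin d) ℂ) :
    (mixture t (L * swap d * Lᴴ)).PosSemidef ↔
      -((d : ℝ) / (2 * ((d : ℝ) - 1))) ≤ t ∧ t ≤ (d : ℝ) / (2 * ((d : ℝ) + 1)) := by
  have hd2 : (2 : ℝ) ≤ d := by exact_mod_cast hd
  have hd0 : (d : ℂ) ≠ 0 := by exact_mod_cast (by omega : d ≠ 0)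
  set F := L * swap d * Lᴴ with hF
  have hFh : F.IsHermitian := conj_isHermitian swap_isHermitian L
  have hFF : F * F = 1 := by
    rw [hF, conj_mul_conj hL, swap_mul_swap, Matrix.mul_one]
    exact mem_unitaryGroup_iff.1 hL
  have hFt : F.trace = d := by rw [hF, trace_conj hL, trace_swap]
  set P : Op2 d := (((1 / 2 : ℝ)) : ℂ) • (1 + F) with hP
  have hPh : P.IsHermitian := by
    rw [IsHermitian, hP, conjTranspose_smul, conjTranspose_add, conjTranspose_one, hFh.eq]
    simp
  have hPP : P * P = P := by
    simp only [hP, Matrix.smul_mul, Matrix.mul_smul, mul_add, add_mul, hFF, Matrix.mul_one,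
      Matrix.one_mul]
    push_cast
    module
  have hPt : P.trace = (((d : ℝ) ^ 2 + d) / 2 : ℝ) := by
    simp only [hP, trace_smul, trace_add, trace_one, hFt]
    simp
    ring
  have hPt' : (1 - P).trace = (((d : ℝ) ^ 2 - d) / 2 : ℝ) := by
    rw [trace_sub, hPt, trace_one]
    simp
    ring
  have hmix : mixture t F =
      ((((d : ℝ) ^ 2)⁻¹ * (1 - 2 * t / d + 2 * t) : ℝ) : ℂ) • P +
        ((((d : ℝ) ^ 2)⁻¹ * (1 - 2 * t / d - 2 * t) : ℝ) : ℂ) • (1 - P) := by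
    rw [mixture, hP]
    push_cast
    module
  have hdiv (x : ℝ) : 0 ≤ x / d ↔ 0 ≤ x := by rw [le_div_iff₀ (by linarith), zero_mul]
  have hpos : 0 < ((d : ℝ) ^ 2)⁻¹ := by positivity
  rw [hmix, posSemidef_projection_iff hPh hPP (by rw [hPt]; exact Complex.zero_lt_real.2 (by positivity))
    (by rw [hPt']; exact Complex.zero_lt_real.2 (by nlinarith)), mul_nonneg_iff_of_pos_left hpos,
    mul_nonneg_iff_of_pos_left hpos]
  have e1 : 1 - 2 * t / d + 2 * t = (d + 2 * t * (d - 1)) / d := by field_simp; ring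
  have e2 : 1 - 2 * t / d - 2 * t = (d - 2 * t * (d + 1)) / d := by field_simp; ring
  rw [e1, e2, neg_le, hdiv,
    hdiv, le_div_iff₀ (by linarith), le_div_iff₀ (by linarith)]
  constructor <;> rintro ⟨h1, h2⟩ <;> constructor <;> linarith

/-- `ent d / d` is a projection of trace `1`. -/
theorem posSemidef_mixture_ent_iff (hd : 2 ≤ d) (t : ℝ) {L : Op2 d}
    (hL : L ∈ unitaryGroup (Fin d × Fin d) ℂ) :
    (mixture t (L * ent d * Lᴴ)).PosSemidef ↔
      -((d : ℝ) / (2 * ((d : ℝ) ^ 2 - 1))) ≤ t ∧ t ≤ (d : ℝ) / 2 := by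
  have hd2 : (2 : ℝ) ≤ d := by exact_mod_cast hd
  have hd0 : (d : ℂ) ≠ 0 := by exact_mod_cast (by omega : d ≠ 0)
  have hd1 : (d : ℝ) ≠ 0 := by positivity
  set F := L * ent d * Lᴴ with hF
  have hFh : F.IsHermitian := conj_isHermitian ent_isHermitian L
  have hFF : F * F = (d : ℂ) • F := by
    rw [hF, conj_mul_conj hL, ent_mul_ent, Matrix.mul_smul, Matrix.smul_mul]
  have hFt : F.trace = d := by rw [hF, trace_conj hL, trace_ent]
  set P : Op2 d := (((d : ℝ)⁻¹ : ℝ) : ℂ) • F with hP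
  have hPh : P.IsHermitian := by
    rw [IsHermitian, hP, conjTranspose_smul, hFh.eq]
    simp
  have hPP : P * P = P := by
    simp only [hP, Matrix.smul_mul, Matrix.mul_smul, hFF, smul_smul]
    congr 1
    push_cast
    field_simp
  have hPt : P.trace = ((1 : ℝ) : ℂ) := by
    simp [hP, hFt, hd0]
  have hPt' : (1 - P).trace = ((d : ℝ) ^ 2 - 1 : ℝ) := by
    rw [trace_sub, hPt, trace_one]
    simp
    ring
  have hFP : F = (d : ℂ) • P := by
    rw [hP, smul_smul]
    simp [hd0]
  have hmix : mixture t F =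
      ((((d : ℝ) ^ 2)⁻¹ * (1 - 2 * t / d + 2 * t * d) : ℝ) : ℂ) • P +
        ((((d : ℝ) ^ 2)⁻¹ * (1 - 2 * t / d) : ℝ) : ℂ) • (1 - P) := by
    rw [mixture, hFP]
    push_cast
    module
  have hdiv (x : ℝ) : 0 ≤ x / d ↔ 0 ≤ x := by rw [le_div_iff₀ (by linarith), zero_mul]
  have hpos : 0 < ((d : ℝ) ^ 2)⁻¹ := by positivity
  rw [hmix, posSemidef_projection_iff hPh hPP (by rw [hPt]; exact_mod_cast one_pos)
    (by rw [hPt']; exact Complex.zero_lt_real.2 (by nlinarith)), mul_nonneg_iff_of_pos_left hpos,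
    mul_nonneg_iff_of_pos_left hpos]
  have e1 : 1 - 2 * t / d + 2 * t * d = (d + 2 * t * (d ^ 2 - 1)) / d := by field_simp; ring
  have e2 : 1 - 2 * t / d = (d - 2 * t) / d := by field_simp
  rw [e1, e2, neg_le, hdiv,
    hdiv, le_div_iff₀ (by nlinarith), le_div_iff₀ two_pos]
  constructor <;> rintro ⟨h1, h2⟩ <;> constructor <;> linarith

/-- Invariance of the swap under `Y ⊗ Y` lets the first factor of `U ⊗ 1` be prescribed. -/
theorem exists_conj_swap {U V : Op d} (hU : U ∈ unitaryGroup (Fin d) ℂ)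
    (hV : V ∈ unitaryGroup (Fin d) ℂ) : ∃ Y ∈ unitaryGroup (Fin d) ℂ,
      (U ⊗ₖ 1) * swap d * (U ⊗ₖ 1)ᴴ = (V ⊗ₖ Y) * swap d * (V ⊗ₖ Y)ᴴ := by
  have hY : star U * V ∈ unitaryGroup (Fin d) ℂ := mul_mem (Unitary.star_mem hU) hV
  refine ⟨star U * V, hY, ?_⟩
  have h : V ⊗ₖ (star U * V) = (U ⊗ₖ (1 : Op d)) * ((star U * V) ⊗ₖ (star U * V)) := by
    rw [← mul_kronecker_mul, ← Matrix.mul_assoc, mem_unitaryGroup_iff.1 hU, Matrix.one_mul,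
      Matrix.one_mul]
  conv_lhs => rw [← swap_conj hY]
  rw [h, conjTranspose_mul]
  simp only [Matrix.mul_assoc]

/-- Invariance of the maximally entangled operator under `Y ⊗ conj Y` lets the first factor of
`U ⊗ W` be prescribed. -/
theorem exists_conj_ent {U W V : Op d} (hU : U ∈ unitaryGroup (Fin d) ℂ)
    (hW : W ∈ unitaryGroup (Fin d) ℂ) (hV : V ∈ unitaryGroup (Fin d) ℂ) :
    ∃ Y ∈ unitaryGroup (Fin d) ℂ,
      (U ⊗ₖ W) * ent d * (U ⊗ₖ W)ᴴ = (V ⊗ₖ Y) * ent d * (V ⊗ₖ Y)ᴴ := by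
  have hY : star U * V ∈ unitaryGroup (Fin d) ℂ := mul_mem (Unitary.star_mem hU) hV
  have hY' : (star U * V).map star ∈ unitaryGroup (Fin d) ℂ := by
    rw [mem_unitaryGroup_iff']
    ext i j
    have := congrArg star (congrFun (congrFun (mem_unitaryGroup_iff'.1 hY) i) j)
    by_cases h : i = j <;> simpa [mul_apply, one_apply, star_apply, h] using this
  refine ⟨W * (star U * V).map star, mul_mem hW hY', ?_⟩
  have h : V ⊗ₖ (W * (star U * V).map star) =
      (U ⊗ₖ W) * ((star U * V) ⊗ₖ (star U * V).map star) := by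
    rw [← mul_kronecker_mul, ← Matrix.mul_assoc, mem_unitaryGroup_iff.1 hU, Matrix.one_mul]
  conv_lhs => rw [← ent_conj hY]
  rw [h, conjTranspose_mul]
  simp only [Matrix.mul_assoc]

end Classes
end QuditDiscord

open QuditDiscord Polynomial in
theorem theorem6 (d : ℕ) (hd : 2 ≤ d) (lam : Fin (d ^ 2 - 1) → Op d) (hlam : IsGenerators lam) :
    -- The class `𝔈^a`: admissible parameters, discord, spectrum of `Q`.
    ((∀ V ∈ adjointGroup lam, ∀ t : ℝ,
        (lmmStates lam (t • V)).Nonempty ↔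
          -((d : ℝ) / (2 * ((d : ℝ) - 1))) ≤ t ∧ t ≤ (d : ℝ) / (2 * ((d : ℝ) + 1))) ∧
      ∀ t : ℝ, ∀ ρ ∈ classA lam t,
        IsLeast (discordValues ρ) (discord ρ) ∧ discord ρ = |t| ∧
        ∀ P : Measurement d,
          (disturbanceSq P ρ).charpoly =
            (X - C (4 * (t : ℂ) ^ 2 / (d : ℂ) ^ 4)) ^ (d * (d - 1)) * X ^ d) ∧
    -- The class `𝔈^aa`: admissible parameters, discord, spectrum of `Q`.
    ((∀ V₁ ∈ adjointGroup lam, ∀ V₂ ∈ adjointGroup lam, ∀ t : ℝ,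
        (lmmStates lam (t • (V₁ * transpositionMatrix lam * V₂ᵀ))).Nonempty ↔
          -((d : ℝ) / (2 * ((d : ℝ) ^ 2 - 1))) ≤ t ∧ t ≤ (d : ℝ) / 2) ∧
      ∀ t : ℝ, ∀ ρ ∈ classAA lam t,
        IsLeast (discordValues ρ) (discord ρ) ∧ discord ρ = 2 / (d : ℝ) * |t| ∧
        ∀ P : Measurement d,
          (disturbanceSq P ρ).charpoly =
            (X - C (4 * (t : ℂ) ^ 2 * ((d : ℂ) - 1) ^ 2 / (d : ℂ) ^ 4)) *
              (X - C (4 * (t : ℂ) ^ 2 / (d : ℂ) ^ 4)) ^ (d - 1) * X ^ (d * (d - 1))) := by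
  have hd0 : 0 < d := by omega
  have hd2 : (2 : ℝ) ≤ d := by exact_mod_cast hd
  have hd1 : (d : ℝ) - 1 ≠ 0 := by linarith
  have hdR : (d : ℝ) ≠ 0 := by linarith
  have habs (t : ℝ) : |2 * t / (d : ℝ) ^ 2| = 2 * |t| / (d : ℝ) ^ 2 := by
    rw [abs_div, abs_mul, abs_two, abs_of_pos (by positivity : (0 : ℝ) < (d : ℝ) ^ 2)]
  have hsq (t : ℝ) : (2 * (t : ℂ) / (d : ℂ) ^ 2) ^ 2 = 4 * (t : ℂ) ^ 2 / (d : ℂ) ^ 4 := by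
    rw [div_pow, mul_pow, ← pow_mul]
    norm_num
  refine ⟨⟨?_, ?_⟩, ⟨?_, ?_⟩⟩
  · rintro V ⟨U, hU, rfl⟩ t
    replace hU := mem_unitary_of_special hU
    have hL := kronecker_mem_unitary hU (one_mem (unitaryGroup (Fin d) ℂ))
    rw [← posSemidef_mixture_swap_iff hd t hL,
      ← isState_mixture_iff hd0 t (ptraceA_conj ptraceA_swap hU (one_mem _))]
    simp only [Set.Nonempty, hlam.mem_lmmStates_adjoint_iff hd0 hU, exists_eq_left]
  · rintro t ρ ⟨V, ⟨U, hU, rfl⟩, hρ⟩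
    replace hU := mem_unitary_of_special hU
    obtain ⟨rfl, -⟩ := (hlam.mem_lmmStates_adjoint_iff hd0 hU t).1 hρ
    have hF := offDiag_isHermitian (swap_isHermitian (d := d))
    obtain ⟨⟨h1, h2⟩, h3⟩ := discord_mixture (fun V hV => exists_conj_swap hU hV)
      posSemidef_offDiagProj (by rw [hF.eq, offDiag_swap_mul_self, offDiagProj_mul_self]) t
    refine ⟨h1, ?_, fun P => ?_⟩
    · have : (offDiagProj d).trace.re = d * (d - 1) := by
        rw [trace_offDiagProj]
        simp
      rw [h2, habs, this]
      field_simp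
    · rw [h3, hF.eq, offDiag_swap_mul_self, charpoly_smul_offDiagProj, hsq]
  · rintro V₁ ⟨U, hU, rfl⟩ V₂ ⟨W, hW, rfl⟩ t
    replace hU := mem_unitary_of_special hU
    replace hW := mem_unitary_of_special hW
    rw [← posSemidef_mixture_ent_iff hd t (kronecker_mem_unitary hU hW),
      ← isState_mixture_iff hd0 t (ptraceA_conj ptraceA_ent hU hW)]
    simp only [Set.Nonempty, hlam.mem_lmmStates_transposition_iff hd0 hU hW, exists_eq_left]
  · rintro t ρ ⟨V₁, ⟨U, hU, rfl⟩, V₂, ⟨W, hW, rfl⟩, hρ⟩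
    replace hU := mem_unitary_of_special hU
    replace hW := mem_unitary_of_special hW
    obtain ⟨rfl, -⟩ := (hlam.mem_lmmStates_transposition_iff hd0 hU hW t).1 hρ
    have hF := offDiag_isHermitian (ent_isHermitian (d := d))
    obtain ⟨⟨h1, h2⟩, h3⟩ := discord_mixture (fun V hV => exists_conj_ent hU hW hV)
      (posSemidef_absOffDiagEnt hd) (by rw [hF.eq, absOffDiagEnt_mul_self hd0]) t
    refine ⟨h1, ?_, fun P => ?_⟩
    · have : (absOffDiagEnt d).trace.re = 2 * (d - 1) := by
        rw [trace_absOffDiagEnt hd0]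
        simp
      rw [h2, habs, this]
      field_simp
    · rw [h3, hF.eq, charpoly_smul_offDiag_ent hd0, hsq]
      congr 4
      ring
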